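/- Let $E$ be the elliptic curve $y^2 = x^3 - 2x$ over $\mathbb{Q}$ and let $P = (2,2) \in E(\mathbb{Q})$, a point of infinite order. For $k \ge 0$ write $2^k P = \left(\frac{m_k}{e_k^2}, \frac{n_k}{e_k^3}\right)$ with integers $m_k, n_k$ and $e_k > 0$ such that $\gcd(m_k,e_k) = \gcd(n_k,e_k) = 1$, and define the elliptic Fermat numbers $F_0(E,P) = e_0$ and $F_k(E,P) = e_k/e_{k-1}$ for $k \ge 1$; these are integers. Then for every integer $n \ge 0$ and every prime $p$ dividing $F_n(E,P)$, $$p \equiv \begin{cases} 1 \pmod{2^n} & \text{if } p \equiv 1 \pmod 4,\\ -1 \pmod{2^n} & \text{if } p \equiv -1 \pmod 4. \end{cases}$$ -/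

import Mathlib

namespace EllFermat

/-- The curve `y² = x³ + a x² + b x + c` over `ℚ`, with integer coefficients `a, b, c`. -/
def curve (a b c : ℤ) : WeierstrassCurve.Affine ℚ := ⟨0, (a : ℚ), 0, (b : ℚ), (c : ℚ)⟩

/-- The denominator `e` of a rational point: if `(x, y) = (m / e², n / e³)` with `e > 0` and
`gcd(m, e) = gcd(n, e) = 1`, then the reduced denominator of `x` is `e²`, so that `e` is its
square root (see `denom_spec`, `denom_eq`). The point at infinity `(0 : 1 : 0)` has `e = 0`. -/
def denom {a b c : ℤ} : (curve a b c).Point → ℕ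
  | .zero => 0
  | .some x _ _ => Nat.sqrt x.den

/-- The denominator `e_k` of `2 ^ k P`. -/
def e {a b c : ℤ} (P : (curve a b c).Point) (k : ℕ) : ℕ := denom ((2 ^ k : ℕ) • P)

/-- The elliptic Fermat numbers of a point `P` (of infinite order): `F_0 = e_0` and
`F_k = e_k / e_{k-1}` for `k ≥ 1`. The division is exact, see `fermat_succ_mul`. -/
def fermat {a b c : ℤ} (P : (curve a b c).Point) : ℕ → ℕ
  | 0 => e P 0
  | k + 1 => e P (k + 1) / e P k

theorem equation_iff {a b c : ℤ} (x y : ℚ) :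
    (curve a b c).Equation x y ↔ y ^ 2 = x ^ 3 + a * x ^ 2 + b * x + c := by
  rw [WeierstrassCurve.Affine.equation_iff]
  simp [curve]

theorem den_sq_of_coprime {m : ℤ} {d : ℕ} (hd : 0 < d) (h : IsCoprime m (d : ℤ)) :
    ((m : ℚ) / (d : ℚ)).den = d := by
  have := Rat.den_div_eq_of_coprime (a := m) (b := (d : ℤ)) (by exact_mod_cast hd)
    (Int.isCoprime_iff_gcd_eq_one.1 h)
  exact_mod_cast this

/-- A point of the curve can be written as `(m / e², n / e³)` with `e > 0` and
`gcd(m, e) = gcd(n, e) = 1`, where `e` is its denominator. -/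
theorem denom_spec {a b c : ℤ} (x y : ℚ) (h : (curve a b c).Nonsingular x y) :
    0 < denom (.some x y h) ∧ ∃ m n : ℤ,
      IsCoprime m (denom (.some x y h) : ℤ) ∧ IsCoprime n (denom (.some x y h) : ℤ) ∧
      x = m / (denom (.some x y h) : ℚ) ^ 2 ∧ y = n / (denom (.some x y h) : ℚ) ^ 3 := by
  have heq := (equation_iff x y).1 h.1
  have hcx : IsCoprime x.num (x.den : ℤ) := Rat.isCoprime_num_den x
  have hcy : IsCoprime y.num (y.den : ℤ) := Rat.isCoprime_num_den y
  have hx0 : (x.den : ℚ) ≠ 0 := by exact_mod_cast x.den_nz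
  have hx : x = x.num / (x.den : ℚ) := (Rat.num_div_den x).symm
  have hy : y = y.num / (y.den : ℚ) := (Rat.num_div_den y).symm
  set N : ℤ := x.num ^ 3 + x.den * (a * x.num ^ 2 + b * x.num * x.den + c * x.den ^ 2) with hN
  have hNc : IsCoprime N ((x.den ^ 3 : ℕ) : ℤ) := by
    push_cast
    exact (hcx.pow_left (m := 3)).add_mul_left_left _ |>.pow_right
  have h1 : (y ^ 2).den = x.den ^ 3 := by
    have : y ^ 2 = (N : ℚ) / ((x.den ^ 3 : ℕ) : ℚ) := by
      rw [heq, hN]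
      conv_lhs => rw [hx]
      push_cast
      field_simp
      ring
    rw [this]
    exact den_sq_of_coprime (pow_pos x.den_pos 3) hNc
  rw [Rat.den_pow] at h1
  obtain ⟨r, hr⟩ : ∃ r : ℕ, x.den = r ^ 2 := by
    have hdvd : x.den ^ 2 ∣ y.den ^ 2 := ⟨x.den, by rw [h1]; ring⟩
    obtain ⟨r, hr⟩ := (Nat.pow_dvd_pow_iff two_ne_zero).1 hdvd
    refine ⟨r, ?_⟩
    rw [hr, mul_pow, pow_succ] at h1
    exact (Nat.eq_of_mul_eq_mul_left (pow_pos x.den_pos 2) h1).symm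
  have hs : denom (.some x y h) = r := by
    change Nat.sqrt x.den = r
    rw [hr, Nat.sqrt_eq']
  have hyr : y.den = r ^ 3 := by
    rw [hr] at h1
    exact Nat.pow_left_injective (n := 2) two_ne_zero (by simp only [h1]; ring)
  have hr0 : 0 < r := by
    rcases Nat.eq_zero_or_pos r with h0 | h0
    · exact absurd hr (by simp [h0])
    · exact h0
  rw [hs]
  refine ⟨hr0, x.num, y.num, ?_, ?_, ?_, ?_⟩
  · rw [hr] at hcx
    push_cast at hcx
    exact (IsCoprime.pow_right_iff two_pos).1 hcx
  · rw [hyr] at hcy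
    push_cast at hcy
    exact (IsCoprime.pow_right_iff three_pos).1 hcy
  · conv_lhs => rw [hx, hr]
    push_cast
    rfl
  · conv_lhs => rw [hy, hyr]
    push_cast
    rfl

/-- The `e` in such an expression is unique. -/
theorem denom_eq {a b c : ℤ} (x y : ℚ) (h : (curve a b c).Nonsingular x y) (m : ℤ) (r : ℕ)
    (hr : 0 < r) (hm : IsCoprime m (r : ℤ)) (hx : x = m / (r : ℚ) ^ 2) :
    denom (.some x y h) = r := by
  have : x.den = r ^ 2 := by
    rw [hx]
    have := den_sq_of_coprime (m := m) (d := r ^ 2) (pow_pos hr 2)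
      (by push_cast; exact hm.pow_right)
    push_cast at this
    exact this
  change Nat.sqrt x.den = r
  rw [this, Nat.sqrt_eq']

theorem dvd_of_dup {a b c m n m' : ℤ} {r r' : ℕ} {x y x' : ℚ} (hr : 0 < r) (hr' : 0 < r')
    (hm : IsCoprime m (r : ℤ)) (hx : x = m / (r : ℚ) ^ 2) (hy : y = n / (r : ℚ) ^ 3)
    (hx' : x' = m' / (r' : ℚ) ^ 2)
    (hdup : x' * (4 * y ^ 2) = x ^ 4 - 2 * b * x ^ 2 - 8 * c * x + b ^ 2 - 4 * a * c) :
    r ∣ r' := by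
  have hrq : (r : ℚ) ≠ 0 := by exact_mod_cast hr.ne'
  have hrq' : (r' : ℚ) ≠ 0 := by exact_mod_cast hr'.ne'
  obtain ⟨A, hA⟩ : ∃ A : ℤ, A = m ^ 4 + r * (r ^ 3 * (-2 * b * m ^ 2 - 8 * c * m * r ^ 2 +
    (b ^ 2 - 4 * a * c) * r ^ 4)) := ⟨_, rfl⟩
  have hAc : IsCoprime A (r : ℤ) := by
    rw [hA]
    exact (hm.pow_left (m := 4)).add_mul_left_left _
  have hkey : m' * (4 * n ^ 2 * (r : ℤ) ^ 2) = A * (r' : ℤ) ^ 2 := by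
    have hx1 : x * (r : ℚ) ^ 2 = m := by rw [hx]; field_simp
    have hy1 : y * (r : ℚ) ^ 3 = n := by rw [hy]; field_simp
    have hx1' : x' * (r' : ℚ) ^ 2 = m' := by rw [hx']; field_simp
    have : ((m' * (4 * n ^ 2 * (r : ℤ) ^ 2) : ℤ) : ℚ) = ((A * (r' : ℤ) ^ 2 : ℤ) : ℚ) := by
      rw [hA]
      push_cast
      rw [← hx1, ← hy1, ← hx1']
      linear_combination (r : ℚ) ^ 8 * (r' : ℚ) ^ 2 * hdup
    exact_mod_cast this
  have hdvd : (r : ℤ) ^ 2 ∣ A * (r' : ℤ) ^ 2 := ⟨m' * (4 * n ^ 2), by rw [← hkey]; ring⟩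
  have h2 : (r : ℤ) ^ 2 ∣ (r' : ℤ) ^ 2 := (hAc.symm.pow_left (m := 2)).dvd_of_dvd_mul_left hdvd
  have h3 : (r : ℤ) ∣ (r' : ℤ) := (Int.pow_dvd_pow_iff two_ne_zero).1 h2
  exact_mod_cast h3

theorem duplication {a b c : ℤ} (x y : ℚ) (h : (curve a b c).Equation x y)
    (hy : y ≠ (curve a b c).negY x y) :
    (curve a b c).addX x x ((curve a b c).slope x x y y) * (4 * y ^ 2) =
      x ^ 4 - 2 * b * x ^ 2 - 8 * c * x + b ^ 2 - 4 * a * c := by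
  have hy0 : y ≠ 0 := fun h0 => hy (by simp [WeierstrassCurve.Affine.negY, curve, h0])
  have heq := (equation_iff x y).1 h
  have hs : (curve a b c).slope x x y y = (3 * x ^ 2 + 2 * a * x + b) / (2 * y) := by
    rw [WeierstrassCurve.Affine.slope_of_Y_ne rfl hy]
    simp only [WeierstrassCurve.Affine.negY, curve]
    congr 1 <;> ring
  obtain ⟨s, hs'⟩ : ∃ s : ℚ, s = (3 * x ^ 2 + 2 * a * x + b) / (2 * y) := ⟨_, rfl⟩
  have hs2 : s * (2 * y) = 3 * x ^ 2 + 2 * a * x + b := by rw [hs']; field_simp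
  rw [hs, ← hs']
  simp only [WeierstrassCurve.Affine.addX, curve]
  linear_combination (s * (2 * y) + (3 * x ^ 2 + 2 * a * x + b)) * hs2 - (4 * a + 8 * x) * heq

theorem denom_dvd_denom_add_self {a b c : ℤ} (P : (curve a b c).Point) :
    denom P ∣ denom (P + P) := by
  rcases P with _ | ⟨x, y, h⟩
  · change denom (0 : (curve a b c).Point) ∣ denom (0 + 0 : (curve a b c).Point)
    rw [add_zero]
  by_cases hy : y = (curve a b c).negY x y
  · rw [WeierstrassCurve.Affine.Point.add_self_of_Y_eq hy]
    exact dvd_zero _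
  rw [WeierstrassCurve.Affine.Point.add_self_of_Y_ne hy]
  obtain ⟨hr, m, n, hm, _, hxm, hyn⟩ := denom_spec x y h
  obtain ⟨hr', m', n', _, _, hxm', _⟩ := denom_spec _ _
    (WeierstrassCurve.Affine.nonsingular_add h h fun hxy => hy hxy.right)
  exact dvd_of_dup hr hr' hm hxm hyn hxm' (duplication x y h.1 hy)

/-- The quotients defining the elliptic Fermat numbers are exact: `F_{k+1} e_k = e_{k+1}`. -/
theorem fermat_succ_mul {a b c : ℤ} (P : (curve a b c).Point) (k : ℕ) :
    fermat P (k + 1) * e P k = e P (k + 1) := by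
  apply Nat.div_mul_cancel
  unfold e
  rw [pow_succ, mul_nsmul, two_nsmul]
  exact denom_dvd_denom_add_self _

/-- The curve `y² = x³ - 2x`. -/
abbrev E : WeierstrassCurve.Affine ℚ := curve 0 (-2) 0

theorem E_discr : E.Δ = 512 := by
  norm_num [curve, WeierstrassCurve.Δ, WeierstrassCurve.b₂, WeierstrassCurve.b₄,
    WeierstrassCurve.b₆, WeierstrassCurve.b₈]

theorem nonsingular_two_two : E.Nonsingular 2 2 := by
  rw [WeierstrassCurve.Affine.nonsingular_iff, equation_iff]
  norm_num [curve]

/-- The point `(2, 2)` of `y² = x³ - 2x`. -/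
def P : E.Point := .some 2 2 nonsingular_two_two

end EllFermat

/-! Let `p` be an odd prime dividing `F_{k+1}`. Then `p ∣ e_{k+1}` but `p ∤ e_k`, so the reduction
of `P` modulo `p` has order exactly `2 ^ (k + 1)` in the group of points of `y² = x³ - 2x` over
`ZMod p` (`exists_point_of_dvd_fermat`). That group has `p + 1 + s` elements, with `s` a Jacobsthal
sum (`card_twist_point`).

If `p ≡ 3 mod 4`, then `s = 0` and Lagrange's theorem gives `2 ^ (k + 1) ∣ p + 1`.

If `p ≡ 1 mod 4`, Lagrange alone is too weak because `s` is unknown. But the group is a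
`ℤ[i]`-module through `(x, y) ↦ (-x, iy)`, and `2` is a unit times `(1 + i)²`; hence a point of
order `2 ^ (k + 1)` forces `2 ^ (2k + 1)` to divide the group order. Jacobsthal's identity `s² + t²
= 4p` gives `s = 2u`, `t = 2v`, and the order becomes the norm `(u + 1)² + v²`. Divisibility of this
norm gives `2 ^ k ∣ u + 1`, and `p - 1 = (p + 1 + 2u) - 2(u + 1)` is then divisible by `2 ^ (k +
1)`. -/

namespace EllFermat

/-! ### Jacobsthal sums over finite fields of odd characteristic -/

section CharacterSums

open Finset

theorem neg_ne_self_of_ringChar {F : Type*} [Field F] (hF : ringChar F ≠ 2)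
    {x : F} (hx : x ≠ 0) : x ≠ -x := by
  intro h
  have h2 : (2 : F) * x = 0 := by linear_combination h
  exact (mul_ne_zero (Ring.two_ne_zero hF) hx) h2

variable {F : Type*} [Field F] [Fintype F] [DecidableEq F]

/-- The Jacobsthal sum `∑ χ(x³ + a x)` for the quadratic character `χ` of a finite field. -/
def jacobsthal (a : F) : ℤ := ∑ x : F, quadraticChar F (x * (x ^ 2 + a))

theorem sum_quadraticChar_add_mul_add (hF : ringChar F ≠ 2) (u v : F) :
    ∑ a : F, quadraticChar F ((a + u) * (a + v)) =
      (if u = v then (Fintype.card F : ℤ) else 0) - 1 := by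
  split_ifs with h
  · subst h
    rw [← Equiv.sum_comp (Equiv.subRight u)]
    have : ∀ x : F, quadraticChar F ((Equiv.subRight u x + u) * (Equiv.subRight u x + u)) =
        1 - if x = 0 then 1 else 0 := by
      intro x
      rw [Equiv.subRight_apply, sub_add_cancel, ← pow_two]
      split_ifs with h
      · simp [h]
      · rw [quadraticChar_sq_one' h, sub_zero]
    rw [sum_congr rfl fun x _ => this x]
    simp
  · have hd : v - u ≠ 0 := sub_ne_zero.2 (Ne.symm h)
    have hJ := jacobiSum_nontrivial_inv (quadraticChar_ne_one hF)
    rw [(quadraticChar_isQuadratic F).inv, jacobiSum] at hJ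
    -- The substitution `a = -(v - u) x - u` turns the sum into `χ(-1)` times the Jacobi sum of `χ`
    -- and `χ⁻¹ = χ`, which is `-χ(-1)`.
    rw [← Equiv.sum_comp ((Equiv.mulLeft₀ (-(v - u)) (neg_ne_zero.2 hd)).trans
      (Equiv.subRight u))]
    have : ∀ x : F, quadraticChar F ((-(v - u) * x - u + u) * (-(v - u) * x - u + v)) =
        quadraticChar F (-1) * (quadraticChar F x * quadraticChar F (1 - x)) := by
      intro x
      have e : (-(v - u) * x - u + u) * (-(v - u) * x - u + v) =
        (v - u) ^ 2 * (-1 * (x * (1 - x))) := by ring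
      rw [e, map_mul, quadraticChar_sq_one' hd, one_mul, map_mul, map_mul]
    simp only [Equiv.trans_apply, Equiv.mulLeft₀_apply, Equiv.subRight_apply, this]
    rw [← mul_sum, hJ, mul_neg, ← pow_two,
      quadraticChar_sq_one (neg_ne_zero.2 one_ne_zero), zero_sub]

theorem jacobsthal_mul_sq (a : F) {t : F} (ht : t ≠ 0) :
    jacobsthal (a * t ^ 2) = quadraticChar F t * jacobsthal a := by
  unfold jacobsthal
  rw [← Equiv.sum_comp (Equiv.mulLeft₀ t ht), mul_sum]
  refine sum_congr rfl fun x _ => ?_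
  have e : t * x * ((t * x) ^ 2 + a * t ^ 2) = t ^ 2 * (t * (x * (x ^ 2 + a))) := by ring
  rw [Equiv.mulLeft₀_apply, e, map_mul, quadraticChar_sq_one' ht, one_mul, map_mul]

/-- Expand the square and sum over `a` first: each pair `(x, y)` gets weight `q · [x² = y²] - 1`.
The `-1` drops out because `χ` sums to zero, and for each `x ≠ 0` the two solutions `y = ±x`
contribute `1` each since `χ(-1) = 1`. -/
theorem sum_jacobsthal_sq (hF : ringChar F ≠ 2) (hneg : quadraticChar F (-1) = 1) :
    ∑ a : F, jacobsthal a ^ 2 = 2 * Fintype.card F * (Fintype.card F - 1) := by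
  have key : ∀ a : F, jacobsthal a ^ 2 = ∑ x : F, ∑ y : F,
      quadraticChar F x * quadraticChar F y * quadraticChar F ((a + x ^ 2) * (a + y ^ 2)) := by
    intro a
    rw [jacobsthal, pow_two, sum_mul_sum]
    refine sum_congr rfl fun x _ => sum_congr rfl fun y _ => ?_
    simp only [map_mul, add_comm a]
    ring
  have inner : ∀ x : F, ∑ y : F, (if x ^ 2 = y ^ 2 then
      quadraticChar F x * quadraticChar F y else 0) = 2 * (1 - if x = 0 then 1 else 0) := by
    intro x
    by_cases hx : x = 0
    · simp [hx]
    · rw [← sum_filter]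
      have hs : (univ.filter fun y : F => x ^ 2 = y ^ 2) = {x, -x} := by
        ext y
        simp only [mem_filter, mem_univ, true_and, mem_insert, mem_singleton]
        rw [eq_comm, sq_eq_sq_iff_eq_or_eq_neg]
      rw [hs, sum_pair (neg_ne_self_of_ringChar hF hx), if_neg hx, neg_eq_neg_one_mul,
        map_mul, hneg, one_mul, ← pow_two, quadraticChar_sq_one hx]
      norm_num
  simp only [key]
  rw [sum_comm]
  simp_rw [sum_comm (s := univ (α := F)) (t := univ (α := F))
    (f := fun a y => quadraticChar F _ * quadraticChar F y * quadraticChar F ((a + _) * _)),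
    ← mul_sum, sum_quadraticChar_add_mul_add hF, mul_sub, mul_one, sum_sub_distrib, ← mul_sum,
    quadraticChar_sum_zero hF, mul_zero, sum_const_zero, sub_zero]
  have h3 : ∀ x y : F, quadraticChar F x * quadraticChar F y *
      (if x ^ 2 = y ^ 2 then (Fintype.card F : ℤ) else 0) =
      Fintype.card F * (if x ^ 2 = y ^ 2 then quadraticChar F x * quadraticChar F y else 0) := by
    intro x y
    split_ifs <;> ring
  simp_rw [h3, ← mul_sum, inner, ← mul_sum]
  simp
  ring

theorem jacobsthal_zero (hF : ringChar F ≠ 2) : jacobsthal (0 : F) = 0 := by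
  rw [← quadraticChar_sum_zero hF, jacobsthal]
  refine sum_congr rfl fun x _ => ?_
  by_cases hx : x = 0
  · simp [hx]
  · rw [add_zero, mul_comm, map_mul, quadraticChar_sq_one' hx, one_mul]

theorem jacobsthal_sq_eq {a c : F} (ha : a ≠ 0)
    (h : quadraticChar F a = quadraticChar F c) : jacobsthal a ^ 2 = jacobsthal c ^ 2 := by
  have hc : c ≠ 0 := by
    rintro rfl
    exact ha (quadraticChar_eq_zero_iff.1 (by rw [h, MulChar.map_zero]))
  have h1 : quadraticChar F (a / c) = 1 := by
    have : quadraticChar F (a / c) * quadraticChar F c = quadraticChar F c := by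
      rw [← map_mul, div_mul_cancel₀ _ hc, h]
    have hc' : quadraticChar F c ≠ 0 := mt quadraticChar_eq_zero_iff.1 hc
    exact mul_right_cancel₀ hc' (by rw [this, one_mul])
  obtain ⟨t, ht⟩ := (quadraticChar_one_iff_isSquare (div_ne_zero ha hc)).1 h1
  have ht0 : t ≠ 0 := by
    rintro rfl
    exact div_ne_zero ha hc (by simpa using ht)
  have : a = c * t ^ 2 := by rw [pow_two, ← ht]; field_simp
  rw [this, jacobsthal_mul_sq c ht0, mul_pow, quadraticChar_sq_one ht0, one_mul]

/-- Jacobsthal's identity. -/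
theorem exists_jacobsthal_sq_add_sq (hF : ringChar F ≠ 2) (hneg : quadraticChar F (-1) = 1)
    {c : F} (hc : c ≠ 0) : ∃ t : ℤ, jacobsthal c ^ 2 + t ^ 2 = 4 * Fintype.card F := by
  obtain ⟨g, hg⟩ := quadraticChar_exists_neg_one hF
  refine ⟨jacobsthal (c * g), ?_⟩
  -- The square of the sum vanishes at `0` and otherwise depends only on `χ(a)`, hence is a
  -- combination of the indicator of `a ≠ 0` and `χ(a)`. Summing over `a` kills the `χ` term.
  have pt : ∀ a : F, 2 * jacobsthal a ^ 2 =
      (1 - if a = 0 then 1 else 0) * (jacobsthal c ^ 2 + jacobsthal (c * g) ^ 2) +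
      quadraticChar F a * (quadraticChar F c * (jacobsthal c ^ 2 - jacobsthal (c * g) ^ 2)) := by
    intro a
    by_cases ha : a = 0
    · simp [ha, jacobsthal_zero hF]
    · rw [if_neg ha]
      by_cases h : quadraticChar F a = quadraticChar F c
      · rw [jacobsthal_sq_eq ha h, h]
        linear_combination (-(jacobsthal c ^ 2 - jacobsthal (c * g) ^ 2)) *
          quadraticChar_sq_one hc
      · have h' : quadraticChar F a = - quadraticChar F c := by
          rcases quadraticChar_dichotomy ha with h1 | h1 <;>
          rcases quadraticChar_dichotomy hc with h2 | h2 <;> simp_all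
        have h2 : quadraticChar F a = quadraticChar F (c * g) := by
          rw [map_mul, hg, h']; ring
        rw [jacobsthal_sq_eq ha h2, h']
        linear_combination ((jacobsthal c ^ 2 - jacobsthal (c * g) ^ 2)) *
          quadraticChar_sq_one hc
  have hs := Finset.sum_congr (rfl : (univ : Finset F) = univ) fun a _ => pt a
  rw [← mul_sum, sum_jacobsthal_sq hF hneg, sum_add_distrib, ← sum_mul, ← sum_mul,
    quadraticChar_sum_zero hF] at hs
  simp only [sum_sub_distrib, sum_const, card_univ, nsmul_eq_mul, mul_one, sum_ite_eq', mem_univ,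
    if_true, zero_mul, add_zero] at hs
  have hq : (Fintype.card F : ℤ) - 1 ≠ 0 := by
    have := Fintype.one_lt_card (α := F)
    omega
  apply mul_left_cancel₀ hq
  rw [← hs]
  ring

/-- The summand is odd under `x ↦ -x` when `χ(-1) = -1`. -/
theorem jacobsthal_eq_zero_of_neg (hneg : quadraticChar F (-1) = -1) (c : F) :
    jacobsthal c = 0 := by
  have : jacobsthal c = - jacobsthal c := by
    conv_lhs => rw [jacobsthal, ← Equiv.sum_comp (Equiv.neg F)]
    rw [jacobsthal, ← sum_neg_distrib]
    refine sum_congr rfl fun x _ => ?_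
    have e : -x * ((-x) ^ 2 + c) = -1 * (x * (x ^ 2 + c)) := by ring
    rw [Equiv.neg_apply, e, map_mul, hneg, neg_one_mul]
  omega

end CharacterSums

/-! ### Orders of finite modules over `ℤ[i]` -/

section Groups

variable {G : Type*} [AddCommGroup G]

/-- If an endomorphism `τ` has `τ ^ j x ≠ 0 = τ ^ (j + 1) x` for some `x` in a stable finite subgroup,
and its kernel is killed by `2`, then `2 ^ (j + 1)` divides the order of the subgroup. -/
theorem two_pow_dvd_card_of_nilpotent [Finite G] (τ : AddMonoid.End G)
    (hτ : ∀ x, τ x = 0 → (2 : ℕ) • x = 0) (j : ℕ) (H : AddSubgroup G) (hH : H.map τ ≤ H)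
    (x : G) (hx : x ∈ H) (h0 : (τ ^ j) x ≠ 0) (h1 : (τ ^ (j + 1)) x = 0) :
    2 ^ (j + 1) ∣ Nat.card H := by
  have hcard : ∀ f : H →+ G, Nat.card H = Nat.card f.range * Nat.card f.ker := by
    intro f
    rw [AddSubgroup.card_eq_card_quotient_mul_card_addSubgroup f.ker,
      Nat.card_congr (QuotientAddGroup.quotientKerEquivRange f).toEquiv]
  obtain ⟨f, hf⟩ : ∃ f : H →+ G, ∀ h : H, f h = τ h :=
    ⟨AddMonoidHom.comp (N := G) τ H.subtype, fun _ => rfl⟩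
  have hrange : f.range = H.map τ := by
    ext z
    constructor
    · rintro ⟨h, rfl⟩
      exact ⟨h, h.2, (hf h).symm⟩
    · rintro ⟨h, hh, rfl⟩
      exact ⟨⟨h, hh⟩, hf _⟩
  have hker : 2 ∣ Nat.card f.ker := by
    have hmem : (τ ^ j) x ∈ H := by
      clear h0 h1
      induction j with
      | zero => exact hx
      | succ j ih =>
        rw [pow_succ']
        exact hH ⟨_, ih, rfl⟩
    have hy : τ ((τ ^ j) x) = 0 := by
      rw [pow_succ'] at h1
      exact h1
    let y : f.ker := ⟨⟨(τ ^ j) x, hmem⟩, (hf _).trans hy⟩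
    have hord : addOrderOf y = 2 := by
      apply addOrderOf_eq_prime
      · ext
        exact hτ _ hy
      · intro h
        apply h0
        have := congrArg (fun z : f.ker => ((z : H) : G)) h
        exact this
    rw [← hord]
    exact addOrderOf_dvd_natCard y
  -- The kernel has even order, as it contains `τ ^ j x`, of order `2`. The remaining factor is the
  -- order of `τ H`, where `τ x` has nilpotency index one less: induct.
  rw [hcard f, hrange]
  cases j with
  | zero => exact dvd_mul_of_dvd_right (by simpa using hker) _
  | succ j =>
    rw [pow_succ]
    refine mul_dvd_mul (two_pow_dvd_card_of_nilpotent τ hτ j (H.map τ)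
      (AddSubgroup.map_mono hH) (τ x) ⟨x, hx, rfl⟩ ?_ ?_) hker
    · rw [pow_succ] at h0
      exact h0
    · rw [pow_succ] at h1
      exact h1

/-- A point of order `2 ^ (n + 1)` in a finite `ℤ[i]`-module forces `2 ^ (2 n + 1)` to divide the
order of the module. -/
theorem two_pow_dvd_card_of_sq_eq_neg_one [Finite G] (ι : AddMonoid.End G) (hι : ι * ι = -1)
    (n : ℕ) (x : G) (h0 : (2 ^ n : ℕ) • x ≠ 0) (h1 : (2 ^ (n + 1) : ℕ) • x = 0) :
    2 ^ (2 * n + 1) ∣ Nat.card G := by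
  -- The prime `1 + i` above `2`: since `τ² = 2ι` with `ι` injective, `τ` acts as a square root of
  -- `2` up to a unit.
  set τ : AddMonoid.End G := 1 + ι with hτ
  have hsq : τ ^ 2 = 2 * ι := by
    rw [hτ, pow_two, add_mul, mul_add, mul_add, hι]
    simp only [one_mul, mul_one]
    rw [two_mul]
    abel
  have hιinj : ∀ y, ι y = 0 → y = 0 := by
    intro y hy
    have : (ι * ι) y = 0 := by
      change ι (ι y) = 0
      rw [hy, map_zero]
    rw [hι] at this
    exact neg_eq_zero.1 this
  have hpow : ∀ k y, (τ ^ (2 * k)) y = (2 ^ k : ℕ) • (ι ^ k) y := by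
    intro k y
    have h2 : Commute (2 : AddMonoid.End G) ι := Nat.cast_commute 2 ι
    have : τ ^ (2 * k) = (2 ^ k : ℕ) • ι ^ k := by
      rw [pow_mul, hsq, h2.mul_pow, nsmul_eq_mul]
      push_cast
      rfl
    rw [this]
    rfl
  have hιk : ∀ k y, (ι ^ k) y = 0 → y = 0 := by
    intro k
    induction k with
    | zero => exact fun y h => h
    | succ k ih =>
      intro y h
      rw [pow_succ] at h
      exact hιinj y (ih _ h)
  have hker : ∀ y, τ y = 0 → (2 : ℕ) • y = 0 := by
    intro y hy
    have : (τ ^ (2 * 1)) y = 0 := by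
      change τ (τ y) = 0
      rw [hy, map_zero]
    rw [hpow, pow_one, pow_one, ← map_nsmul] at this
    exact hιinj _ this
  have hne : (τ ^ (2 * n)) x ≠ 0 := by
    rw [hpow, ← map_nsmul]
    exact fun h => h0 (hιk _ _ h)
  have hex : ∃ j, (τ ^ j) x = 0 := ⟨2 * (n + 1), by rw [hpow, ← map_nsmul, h1, map_zero]⟩
  classical
  obtain ⟨j, hj⟩ : ∃ j, Nat.find hex = j + 1 := by
    refine Nat.exists_eq_succ_of_ne_zero fun h => h0 ?_
    have := Nat.find_spec hex
    rw [h] at this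
    have hx : x = 0 := this
    rw [hx, smul_zero]
  have hj1 := Nat.find_spec hex
  rw [hj] at hj1
  have hj0 : (τ ^ j) x ≠ 0 := Nat.find_min hex (by omega)
  -- The first power of `τ` killing `x` is `j + 1`; it exceeds `2n` because `τ ^ (2n) x` is, up to
  -- `ι ^ n`, the nonzero `2 ^ n x`.
  have hle : 2 * n ≤ j := by
    by_contra hlt
    apply hne
    obtain ⟨d, hd⟩ := Nat.exists_eq_add_of_le (show j + 1 ≤ 2 * n by omega)
    rw [hd, add_comm, pow_add]
    change (τ ^ d) ((τ ^ (j + 1)) x) = 0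
    rw [hj1, map_zero]
  have := two_pow_dvd_card_of_nilpotent τ hker j ⊤ le_top x trivial hj0 hj1
  rw [Nat.card_congr AddSubgroup.topEquiv.toEquiv] at this
  exact (pow_dvd_pow 2 (by omega)).trans this

end Groups

/-! ### The curves `y² = x³ + c x`: multiplication by `i` and point count -/

section QuarticTwist

open WeierstrassCurve

variable {F : Type*} [Field F]

/-- The curve `y² = x³ + c x` over a field. -/
def twist (c : F) : WeierstrassCurve.Affine F := ⟨0, 0, 0, c, 0⟩

theorem twist_equation_iff {c x y : F} :
    (twist c).Equation x y ↔ y ^ 2 = x * (x ^ 2 + c) := by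
  rw [WeierstrassCurve.Affine.equation_iff]
  simp only [twist]
  constructor <;> intro h <;> linear_combination h

theorem twist_negY (c x y : F) : (twist c).negY x y = -y := by
  simp [Affine.negY, twist]

theorem twist_nonsingular_iff {c x y : F} (h2 : (2 : F) ≠ 0) (hc : c ≠ 0) :
    (twist c).Nonsingular x y ↔ y ^ 2 = x * (x ^ 2 + c) := by
  rw [← twist_equation_iff, (twist c).equation_iff_nonsingular_of_Δ_ne_zero]
  have : (twist c).Δ = -(2 ^ 6 * c ^ 3) := by
    simp only [twist, WeierstrassCurve.Δ, WeierstrassCurve.b₂, WeierstrassCurve.b₄,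
      WeierstrassCurve.b₆, WeierstrassCurve.b₈]
    ring
  rw [this]
  exact neg_ne_zero.2 (mul_ne_zero (pow_ne_zero _ h2) (pow_ne_zero _ hc))

theorem some_congr {c x y x' y' : F} {h : (twist c).Nonsingular x y}
    {h' : (twist c).Nonsingular x' y'} (hx : x = x') (hy : y = y') :
    Affine.Point.some x y h = Affine.Point.some x' y' h' := by
  subst hx hy
  rfl

theorem nonsingular_mul_i {c i x y : F} (hi : i ^ 2 = -1) (h : (twist c).Nonsingular x y) :
    (twist c).Nonsingular (-x) (i * y) := by
  have hi0 : i ≠ 0 := by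
    rintro rfl
    simp at hi
  rw [Affine.nonsingular_iff', twist_equation_iff] at h ⊢
  obtain ⟨h1, h2⟩ := h
  refine ⟨by linear_combination y ^ 2 * hi - h1, ?_⟩
  simp only [twist] at h2 ⊢
  rcases h2 with h2 | h2
  · left
    convert h2 using 1
    ring
  · right
    have : 2 * (i * y) + 0 * -x + 0 = i * (2 * y + 0 * x + 0) := by ring
    rw [this]
    exact mul_ne_zero hi0 h2

/-- Multiplication by `i` on the points of `y² = x³ + c x`. -/
def mulI {c : F} (i : F) (hi : i ^ 2 = -1) : (twist c).Point → (twist c).Point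
  | .zero => .zero
  | .some _ _ h => .some _ _ (nonsingular_mul_i hi h)

variable [DecidableEq F]

/-- For secants the factor is `i / (-1)`; for tangents it is `i⁻¹`, coming from the denominator
`2y`. Both equal `-i`. -/
theorem slope_mul_i {c i x₁ x₂ y₁ y₂ : F} (hi : i ^ 2 = -1) :
    (twist c).slope (-x₁) (-x₂) (i * y₁) (i * y₂) = -i * (twist c).slope x₁ x₂ y₁ y₂ := by
  have hi0 : i ≠ 0 := by
    rintro rfl
    simp at hi
  by_cases hx : x₁ = x₂
  · by_cases hy : y₁ = -y₂
    · rw [Affine.slope_of_Y_eq hx (by rw [twist_negY, hy]),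
        Affine.slope_of_Y_eq (by rw [hx]) (by rw [twist_negY, hy, mul_neg]), mul_zero]
    · rw [Affine.slope_of_Y_ne hx (by rwa [twist_negY]), Affine.slope_of_Y_ne (by rw [hx])
        (by rw [twist_negY, ← mul_neg]; exact fun h => hy (mul_left_cancel₀ hi0 h)),
        twist_negY, twist_negY]
      simp only [twist]
      have e : i * y₁ - -(i * y₁) = i * (y₁ - -y₁) := by ring
      have e2 : i⁻¹ = -i := by
        apply inv_eq_of_mul_eq_one_right
        linear_combination -hi
      rw [e, div_eq_mul_inv, mul_inv, e2]
      ring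
  · rw [Affine.slope_of_X_ne hx, Affine.slope_of_X_ne (fun h => hx (neg_injective h))]
    have e : -x₁ - -x₂ = -(x₁ - x₂) := by ring
    rw [e, div_neg, ← mul_sub]
    ring

theorem mulI_add {c i : F} (hi : i ^ 2 = -1) (P Q : (twist c).Point) :
    mulI i hi (P + Q) = mulI i hi P + mulI i hi Q := by
  have hi0 : i ≠ 0 := by
    rintro rfl
    simp at hi
  rcases P with _ | ⟨x₁, y₁, h₁⟩
  · change mulI i hi (0 + Q) = 0 + mulI i hi Q
    rw [zero_add, zero_add]
  rcases Q with _ | ⟨x₂, y₂, h₂⟩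
  · change mulI i hi (_ + 0) = mulI i hi _ + 0
    rw [add_zero, add_zero]
  by_cases hxy : x₁ = x₂ ∧ y₁ = (twist c).negY x₂ y₂
  · rw [Affine.Point.add_of_Y_eq hxy.1 hxy.2]
    simp only [mulI]
    rw [Affine.Point.add_of_Y_eq (by rw [hxy.1]) (by rw [hxy.2, twist_negY, twist_negY, mul_neg])]
    rfl
  · rw [Affine.Point.add_some hxy]
    simp only [mulI]
    rw [Affine.Point.add_some (by
      rintro ⟨h3, h4⟩
      refine hxy ⟨neg_injective h3, ?_⟩
      rw [twist_negY] at h4 ⊢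
      rw [← mul_neg] at h4
      exact mul_left_cancel₀ hi0 h4)]
    apply some_congr
    · rw [slope_mul_i hi]
      simp only [Affine.addX, twist]
      generalize Affine.slope _ x₁ x₂ y₁ y₂ = s
      linear_combination -s ^ 2 * hi
    · rw [slope_mul_i hi]
      simp only [Affine.addY, Affine.negAddY, Affine.addX, Affine.negY, twist]
      generalize Affine.slope _ x₁ x₂ y₁ y₂ = s
      linear_combination -(i * s ^ 3) * hi

/-- Multiplication by `i` as an endomorphism of the group of points. -/
def mulIHom {c : F} (i : F) (hi : i ^ 2 = -1) : AddMonoid.End (twist c).Point where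
  toFun := mulI i hi
  map_zero' := rfl
  map_add' := mulI_add hi

theorem mulIHom_mul_self {c i : F} (hi : i ^ 2 = -1) :
    mulIHom (c := c) i hi * mulIHom i hi = -1 := by
  ext P
  change mulI i hi (mulI i hi P) = -P
  rcases P with _ | ⟨x, y, h⟩
  · rfl
  · rw [Affine.Point.neg_some]
    apply some_congr
    · ring
    · rw [twist_negY]
      linear_combination y * hi

instance twist_point_finite [Finite F] (c : F) : Finite (twist c).Point :=
  have : Finite (WithZero {xy : F × F // (twist c).Nonsingular xy.fst xy.snd}) :=
    inferInstanceAs (Finite (Option _))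
  Finite.of_equiv _ ((twist c).nonsingularPointEquiv).symm

/-- Above each `x` there are `1 + χ(x³ + c x)` values of `y`; the extra `1` is the point at
infinity. -/
theorem card_twist_point [Fintype F] (hF : ringChar F ≠ 2) {c : F} (hc : c ≠ 0) :
    (Nat.card (twist c).Point : ℤ) = Fintype.card F + 1 + jacobsthal c := by
  have h2 := Ring.two_ne_zero hF
  have e : {xy : F × F // (twist c).Nonsingular xy.fst xy.snd} ≃
      Σ x : F, {y : F // y ^ 2 = x * (x ^ 2 + c)} :=
    { toFun := fun z => ⟨z.1.1, z.1.2, (twist_nonsingular_iff h2 hc).1 z.2⟩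
      invFun := fun z => ⟨(z.1, z.2.1), (twist_nonsingular_iff h2 hc).2 z.2.2⟩
      left_inv := fun _ => rfl
      right_inv := fun _ => rfl }
  have h1 : Nat.card (twist c).Point =
      Nat.card (Σ x : F, {y : F // y ^ 2 = x * (x ^ 2 + c)}) + 1 := by
    rw [Nat.card_congr (twist c).nonsingularPointEquiv, ← Nat.card_congr e]
    exact Finite.card_option
  have h3 : ∀ x : F, (Fintype.card {y : F // y ^ 2 = x * (x ^ 2 + c)} : ℤ) =
      quadraticChar F (x * (x ^ 2 + c)) + 1 := by
    intro x
    rw [← quadraticChar_card_sqrts hF, Set.toFinset_card]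
    rfl
  rw [h1, Nat.card_eq_fintype_card, Fintype.card_sigma]
  push_cast
  simp only [h3, Finset.sum_add_distrib, jacobsthal]
  simp
  ring

end QuarticTwist

open WeierstrassCurve

/-! ### Duplication formulas and reduction modulo `p` -/

section Reduction

/-- The tangent-line formulas without division. Taking `W` with an equation `W = twist c` lets the
same lemma serve `E` over `ℚ` and its reductions. -/
theorem exists_add_self_eq {F : Type*} [Field F] [DecidableEq F] (h2 : (2 : F) ≠ 0) {c : F}
    {W : WeierstrassCurve.Affine F} (hW : W = twist c) {x y : F} (h : W.Nonsingular x y)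
    (hy : y ≠ 0) : ∃ x' y' : F, ∃ h' : W.Nonsingular x' y',
      Affine.Point.some x y h + Affine.Point.some x y h = Affine.Point.some x' y' h' ∧
      x' * (4 * y ^ 2) = (x ^ 2 - c) ^ 2 ∧
      2 * y * y' = -2 * y ^ 2 - (3 * x ^ 2 + c) * (x' - x) := by
  subst hW
  have hneg : y ≠ (twist c).negY x y := by
    rw [twist_negY]
    intro h0
    exact mul_ne_zero h2 hy (by linear_combination h0)
  refine ⟨_, _, _, Affine.Point.add_self_of_Y_ne hneg, ?_⟩
  have heq := twist_equation_iff.1 h.1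
  have hs : (twist c).slope x x y y * (2 * y) = 3 * x ^ 2 + c := by
    rw [Affine.slope_of_Y_ne rfl hneg, twist_negY]
    have : y - -y = 2 * y := by ring
    rw [this, div_mul_cancel₀ _ (mul_ne_zero h2 hy)]
    simp only [twist]
    ring
  generalize (twist c).slope x x y y = s at hs
  constructor
  · simp only [Affine.addX, twist]
    linear_combination (s * (2 * y) + (3 * x ^ 2 + c)) * hs - 8 * x * heq
  · simp only [Affine.addY, Affine.negAddY, Affine.addX, Affine.negY, twist]
    linear_combination (-(s ^ 2 - 3 * x)) * hs

theorem add_self_eq_zero_iff {F : Type*} [Field F] [DecidableEq F] (h2 : (2 : F) ≠ 0) {c : F}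
    {W : WeierstrassCurve.Affine F} (hW : W = twist c) {x y : F} (h : W.Nonsingular x y) :
    Affine.Point.some x y h + Affine.Point.some x y h = 0 ↔ y = 0 := by
  constructor
  · intro h0
    by_contra hy
    obtain ⟨x', y', h', hadd, _⟩ := exists_add_self_eq h2 hW h hy
    rw [hadd] at h0
    exact Affine.Point.some_ne_zero _ h0
  · rintro rfl
    subst hW
    exact Affine.Point.add_self_of_Y_eq (by rw [twist_negY, neg_zero])

theorem E_eq_twist : E = twist (-2 : ℚ) := by
  simp [curve, twist]

/-- `Q = (m / r², n / r³)` in lowest terms. -/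
def Represents (Q : E.Point) (m n : ℤ) (r : ℕ) : Prop :=
  0 < r ∧ IsCoprime m (r : ℤ) ∧ IsCoprime n (r : ℤ) ∧
    ∃ h : E.Nonsingular (m / (r : ℚ) ^ 2) (n / (r : ℚ) ^ 3), Q = .some _ _ h

theorem exists_represents {Q : E.Point} (hQ : Q ≠ 0) : ∃ m n, Represents Q m n (denom Q) := by
  rcases Q with _ | ⟨x, y, h⟩
  · exact absurd rfl hQ
  · obtain ⟨hr, m, n, hm, hn, hx, hy⟩ := denom_spec x y h
    generalize hd : denom (Affine.Point.some x y h) = r at *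
    subst hx hy
    exact ⟨m, n, hr, hm, hn, h, rfl⟩

theorem Represents.equation {Q : E.Point} {m n : ℤ} {r : ℕ} (hQ : Represents Q m n r) :
    n ^ 2 = m * (m ^ 2 - 2 * (r : ℤ) ^ 4) := by
  obtain ⟨hr, -, -, h, -⟩ := hQ
  have h1 := (equation_iff _ _).1 h.1
  have hrq : (r : ℚ) ≠ 0 := by exact_mod_cast hr.ne'
  field_simp at h1
  push_cast at h1
  have : (n : ℚ) ^ 2 = m * (m ^ 2 - 2 * (r : ℚ) ^ 4) := by linear_combination h1
  exact_mod_cast this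

theorem Represents.add_self_ne_zero {Q : E.Point} {m n : ℤ} {r : ℕ} (hQ : Represents Q m n r)
    (hn : n ≠ 0) : Q + Q ≠ 0 := by
  obtain ⟨hr, -, -, h, rfl⟩ := hQ
  rw [Ne, add_self_eq_zero_iff two_ne_zero E_eq_twist]
  have hrq : (r : ℚ) ≠ 0 := by exact_mod_cast hr.ne'
  have hnq : (n : ℚ) ≠ 0 := by exact_mod_cast hn
  positivity

/-- Duplication with denominators cleared: identities between integers, which can be cast to `ZMod
p`. -/
theorem Represents.add_self {Q : E.Point} {m n m' n' : ℤ} {r r' : ℕ} (hQ : Represents Q m n r)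
    (hQ' : Represents (Q + Q) m' n' r') :
    m' * (4 * n ^ 2 * (r : ℤ) ^ 2) = (m ^ 2 + 2 * (r : ℤ) ^ 4) ^ 2 * (r' : ℤ) ^ 2 ∧
    2 * n * n' * (r : ℤ) ^ 3 = -2 * n ^ 2 * (r' : ℤ) ^ 3 -
      (3 * m ^ 2 - 2 * (r : ℤ) ^ 4) * (m' * (r : ℤ) ^ 2 - m * (r' : ℤ) ^ 2) * r' := by
  obtain ⟨hr, -, -, h, rfl⟩ := hQ
  obtain ⟨hr', -, -, h', hadd⟩ := hQ'
  have hrq : (r : ℚ) ≠ 0 := by exact_mod_cast hr.ne'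
  have hrq' : (r' : ℚ) ≠ 0 := by exact_mod_cast hr'.ne'
  have hy : (n / (r : ℚ) ^ 3) ≠ 0 := by
    rw [Ne, ← add_self_eq_zero_iff two_ne_zero E_eq_twist h, hadd]
    exact Affine.Point.some_ne_zero _
  obtain ⟨x', y', h'', hadd', h1, h2⟩ := exists_add_self_eq two_ne_zero E_eq_twist h hy
  rw [hadd, Affine.Point.some.injEq] at hadd'
  obtain ⟨rfl, rfl⟩ := hadd'
  obtain ⟨x, hx⟩ : ∃ x, x = (m : ℚ) / r ^ 2 := ⟨_, rfl⟩
  obtain ⟨y, hy⟩ : ∃ y, y = (n : ℚ) / r ^ 3 := ⟨_, rfl⟩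
  obtain ⟨x', hx'⟩ : ∃ x, x = (m' : ℚ) / r' ^ 2 := ⟨_, rfl⟩
  obtain ⟨y', hy'⟩ : ∃ y, y = (n' : ℚ) / r' ^ 3 := ⟨_, rfl⟩
  rw [← hx, ← hy, ← hx'] at h1
  rw [← hx, ← hy, ← hx', ← hy'] at h2
  have ex : (m : ℚ) = x * r ^ 2 := by rw [hx]; field_simp
  have ey : (n : ℚ) = y * r ^ 3 := by rw [hy]; field_simp
  have ex' : (m' : ℚ) = x' * r' ^ 2 := by rw [hx']; field_simp
  have ey' : (n' : ℚ) = y' * r' ^ 3 := by rw [hy']; field_simp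
  constructor
  · have : (m' : ℚ) * (4 * n ^ 2 * (r : ℚ) ^ 2) = (m ^ 2 + 2 * (r : ℚ) ^ 4) ^ 2 * (r' : ℚ) ^ 2 := by
      rw [ex, ey, ex']
      linear_combination (r : ℚ) ^ 8 * (r' : ℚ) ^ 2 * h1
    exact_mod_cast this
  · have : 2 * (n : ℚ) * n' * (r : ℚ) ^ 3 = -2 * n ^ 2 * (r' : ℚ) ^ 3 -
      (3 * m ^ 2 - 2 * (r : ℚ) ^ 4) * (m' * (r : ℚ) ^ 2 - m * (r' : ℚ) ^ 2) * r' := by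
      rw [ex, ey, ex', ey']
      linear_combination (r : ℚ) ^ 6 * (r' : ℚ) ^ 3 * h2
    exact_mod_cast this

variable {p : ℕ} [Fact p.Prime]

/-- `R` is the reduction modulo `p` of the point `Q`, whose denominator is prime to `p`. -/
def ReducesTo (Q : E.Point) (R : (twist (-2 : ZMod p)).Point) : Prop :=
  ∃ (m n : ℤ) (r : ℕ), Represents Q m n r ∧ (r : ZMod p) ≠ 0 ∧
    ∃ h : (twist (-2 : ZMod p)).Nonsingular (m / (r : ZMod p) ^ 2) (n / (r : ZMod p) ^ 3),
      R = .some _ _ h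

theorem ReducesTo.add_self (h2 : (2 : ZMod p) ≠ 0) {Q : E.Point} {R : (twist (-2 : ZMod p)).Point}
    (hR : ReducesTo Q R) {m' n' : ℤ} {r' : ℕ} (hQ' : Represents (Q + Q) m' n' r')
    (hr' : (r' : ZMod p) ≠ 0) : ReducesTo (Q + Q) (R + R) := by
  obtain ⟨m, n, r, hQ, hr, h, rfl⟩ := hR
  obtain ⟨h1, h3⟩ := hQ.add_self hQ'
  have h0 := hQ.equation
  apply_fun (Int.cast : ℤ → ZMod p) at h0 h1 h3
  push_cast at h0 h1 h3
  -- If `n` vanished modulo `p`, then `m² + 2r⁴` would vanish by duplication and `m(m² - 2r⁴)` by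
  -- the curve equation; together they force `m = 0`, then `2r⁴ = 0`.
  have hn : (n : ZMod p) ≠ 0 := by
    intro hn
    rw [hn] at h0 h1
    have h4 : (m : ZMod p) ^ 2 + 2 * (r : ZMod p) ^ 4 = 0 := by
      have : ((m : ZMod p) ^ 2 + 2 * (r : ZMod p) ^ 4) ^ 2 * (r' : ZMod p) ^ 2 = 0 := by
        linear_combination -h1
      exact pow_eq_zero_iff two_ne_zero |>.1
        ((mul_eq_zero.1 this).resolve_right (pow_ne_zero _ hr'))
    have h5 : (m : ZMod p) * (2 ^ 2 * (r : ZMod p) ^ 4) = 0 := by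
      linear_combination h0 + (m : ZMod p) * h4
    have h6 := (mul_eq_zero.1 h5).resolve_right
      (mul_ne_zero (pow_ne_zero _ h2) (pow_ne_zero _ hr))
    rw [h6] at h4
    exact mul_ne_zero h2 (pow_ne_zero 4 hr) (by linear_combination h4)
  obtain ⟨x', y', h', hadd, hx, hy⟩ :=
    exists_add_self_eq h2 rfl h (div_ne_zero hn (pow_ne_zero 3 hr))
  have ex : x' = m' / (r' : ZMod p) ^ 2 := by
    rw [eq_div_iff (pow_ne_zero _ hr')]
    apply mul_left_cancel₀ (mul_ne_zero (mul_ne_zero (pow_ne_zero 2 h2) (pow_ne_zero 2 hn))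
      (pow_ne_zero 2 hr))
    field_simp at hx
    linear_combination (r' : ZMod p) ^ 2 * hx - h1
  have ey : y' = n' / (r' : ZMod p) ^ 3 := by
    rw [eq_div_iff (pow_ne_zero _ hr')]
    have ex2 : x' * (r' : ZMod p) ^ 2 = m' := by rw [ex, div_mul_cancel₀ _ (pow_ne_zero _ hr')]
    rw [← ex2] at h3
    apply mul_left_cancel₀ (mul_ne_zero (mul_ne_zero h2 hn) (pow_ne_zero 3 hr))
    field_simp at hy
    linear_combination (r' : ZMod p) ^ 3 * hy - h3
  subst ex ey
  exact ⟨m', n', r', hQ', hr', h', hadd⟩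

theorem ReducesTo.add_self_eq_zero (h2 : (2 : ZMod p) ≠ 0) {Q : E.Point}
    {R : (twist (-2 : ZMod p)).Point} (hR : ReducesTo Q R) {m' n' : ℤ} {r' : ℕ}
    (hQ' : Represents (Q + Q) m' n' r') (hr' : (r' : ZMod p) = 0) : R + R = 0 := by
  obtain ⟨m, n, r, hQ, hr, h, rfl⟩ := hR
  have h1 := (hQ.add_self hQ').1
  have hm' : (m' : ZMod p) ≠ 0 := by
    obtain ⟨a, b, hab⟩ := hQ'.2.1
    apply_fun (Int.cast : ℤ → ZMod p) at hab
    push_cast at hab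
    rw [hr'] at hab
    intro h0
    rw [h0] at hab
    simp at hab
  apply_fun (Int.cast : ℤ → ZMod p) at h1
  push_cast at h1
  rw [hr'] at h1
  rw [add_self_eq_zero_iff h2 rfl, div_eq_zero_iff]
  left
  -- As `p ∣ r'`, duplication reads `m' · 4n²r² = 0` modulo `p`, while `m'` is prime to `r'`; so `n`
  -- vanishes and the reduction is 2-torsion.
  by_contra hn
  refine mul_ne_zero hm' (mul_ne_zero (mul_ne_zero (pow_ne_zero 2 h2) (pow_ne_zero 2 hn))
    (pow_ne_zero 2 hr)) ?_
  linear_combination h1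

end Reduction

/-! ### The points `2 ^ k P` and the order of their reductions -/

section Multiples

theorem represents_P : Represents P 2 2 1 := by
  refine ⟨one_pos, isCoprime_one_right, isCoprime_one_right, ?_⟩
  have : E.Nonsingular (((2 : ℤ) : ℚ) / ((1 : ℕ) : ℚ) ^ 2) (((2 : ℤ) : ℚ) / ((1 : ℕ) : ℚ) ^ 3) := by
    convert nonsingular_two_two <;> norm_num
  refine ⟨this, ?_⟩
  rw [P, Affine.Point.some.injEq]
  norm_num

theorem two_pow_succ_nsmul (k : ℕ) {A : Type*} [AddCommGroup A] (Q : A) :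
    (2 ^ (k + 1) : ℕ) • Q = (2 ^ k : ℕ) • Q + (2 ^ k : ℕ) • Q := by
  rw [pow_succ, mul_two, add_nsmul]

/-- Parity keeps the doubling going: once the denominator is even, the coprime numerator `n` is odd,
hence nonzero, so the point is not 2-torsion. Evenness is inherited, as denominators divide those of
the doubles. -/
theorem two_pow_succ_nsmul_P_ne_zero (k : ℕ) :
    (2 ^ (k + 1) : ℕ) • P ≠ 0 ∧ 2 ∣ denom ((2 ^ (k + 1) : ℕ) • P) := by
  induction k with
  | zero =>
    rw [two_pow_succ_nsmul, pow_zero, one_nsmul]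
    have h0 := represents_P.add_self_ne_zero two_ne_zero
    refine ⟨h0, ?_⟩
    obtain ⟨m, n, h⟩ := exists_represents h0
    have h1 := (represents_P.add_self h).1
    generalize denom (P + P) = r at h1
    -- Duplicating `(2, 2)` gives `16 m = 36 r²`.
    have h3 : (2 : ℤ) ∣ (r : ℤ) ^ 2 := by
      push_cast at h1
      ring_nf at h1
      omega
    exact_mod_cast Int.prime_two.dvd_of_dvd_pow h3
  | succ k ih =>
    rw [two_pow_succ_nsmul]
    refine ⟨?_, ih.2.trans (denom_dvd_denom_add_self _)⟩
    obtain ⟨m, n, h⟩ := exists_represents ih.1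
    refine h.add_self_ne_zero ?_
    rintro rfl
    have h1 := isCoprime_zero_left.1 h.2.2.1
    have h2 : (2 : ℤ) ∣ (denom ((2 ^ (k + 1) : ℕ) • P) : ℤ) := by exact_mod_cast ih.2
    have h3 := isUnit_of_dvd_unit h2 h1
    rw [Int.isUnit_iff] at h3
    omega

theorem two_pow_nsmul_P_ne_zero (k : ℕ) : (2 ^ k : ℕ) • P ≠ 0 := by
  cases k with
  | zero =>
    rw [pow_zero, one_nsmul]
    exact Affine.Point.some_ne_zero _
  | succ k => exact (two_pow_succ_nsmul_P_ne_zero k).1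

theorem exists_represents_two_pow (k : ℕ) :
    ∃ m n, Represents ((2 ^ k : ℕ) • P) m n (e P k) :=
  exists_represents (two_pow_nsmul_P_ne_zero k)

variable {p : ℕ} [Fact p.Prime]

theorem exists_reducesTo_P (h2 : (2 : ZMod p) ≠ 0) :
    ∃ R : (twist (-2 : ZMod p)).Point, ReducesTo P R := by
  have h : (twist (-2 : ZMod p)).Nonsingular (((2 : ℤ) : ZMod p) / ((1 : ℕ) : ZMod p) ^ 2)
      (((2 : ℤ) : ZMod p) / ((1 : ℕ) : ZMod p) ^ 3) := by
    rw [twist_nonsingular_iff h2 (neg_ne_zero.2 h2)]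
    norm_num
  exact ⟨_, 2, 2, 1, represents_P, by simp, h, rfl⟩

theorem reducesTo_two_pow (h2 : (2 : ZMod p) ≠ 0) {R : (twist (-2 : ZMod p)).Point}
    (hR : ReducesTo P R) (k : ℕ) (hk : (e P k : ZMod p) ≠ 0) :
    ReducesTo ((2 ^ k : ℕ) • P) ((2 ^ k : ℕ) • R) := by
  induction k with
  | zero => simpa using hR
  | succ k ih =>
    have hk' : (e P k : ZMod p) ≠ 0 := by
      intro h0
      rw [← fermat_succ_mul, Nat.cast_mul, h0, mul_zero] at hk
      exact hk rfl
    obtain ⟨m, n, h⟩ := exists_represents_two_pow (k + 1)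
    rw [two_pow_succ_nsmul] at h
    rw [two_pow_succ_nsmul, two_pow_succ_nsmul]
    exact (ih hk').add_self h2 h hk

/-- An odd prime that divides `F_{k+1}` does not divide `e_k`. -/
theorem e_ne_zero_of_dvd_fermat (h2 : (2 : ZMod p) ≠ 0) (k : ℕ)
    (hdvd : (fermat P (k + 1) : ZMod p) = 0) : (e P k : ZMod p) ≠ 0 := by
  intro h0
  obtain ⟨m, n, h⟩ := exists_represents_two_pow k
  obtain ⟨m', n', h'⟩ := exists_represents_two_pow (k + 1)
  have h1 := h'
  rw [two_pow_succ_nsmul] at h1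
  have key := (h.add_self h1).1
  have hr : (e P k : ℤ) ≠ 0 := by exact_mod_cast h.1.ne'
  have hne : ∀ {a : ℤ} {r : ℕ}, IsCoprime a (r : ℤ) → (r : ZMod p) = 0 → (a : ZMod p) ≠ 0 := by
    rintro a r ⟨u, v, huv⟩ hr ha
    apply_fun (Int.cast : ℤ → ZMod p) at huv
    push_cast at huv
    rw [hr, ha] at huv
    simp at huv
  have hn := hne h.2.2.1 h0
  have hm' := hne h'.2.1 (by rw [← fermat_succ_mul, Nat.cast_mul, hdvd, zero_mul])
  rw [← fermat_succ_mul] at key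
  -- Cancelling `e_k²` leaves a multiple of `F_{k+1}²` on the right. If `p` divided both `F_{k+1}`
  -- and `e_k`, then `m'`, `n` and `4` on the left would all be prime to `p`.
  have key2 : m' * (4 * n ^ 2) = (m ^ 2 + 2 * (e P k : ℤ) ^ 4) ^ 2 * (fermat P (k + 1) : ℤ) ^ 2 := by
    apply mul_right_cancel₀ (pow_ne_zero 2 hr)
    push_cast at key
    linear_combination key
  apply_fun (Int.cast : ℤ → ZMod p) at key2
  push_cast at key2
  rw [hdvd] at key2
  refine mul_ne_zero hm' (mul_ne_zero (pow_ne_zero 2 h2) (pow_ne_zero 2 hn)) ?_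
  linear_combination key2

/-- The reduction of `P` modulo an odd prime factor of `F_{k+1}` has order `2 ^ (k + 1)`. -/
theorem exists_point_of_dvd_fermat (h2 : (2 : ZMod p) ≠ 0) (k : ℕ)
    (hdvd : (fermat P (k + 1) : ZMod p) = 0) :
    ∃ R : (twist (-2 : ZMod p)).Point, (2 ^ k : ℕ) • R ≠ 0 ∧ (2 ^ (k + 1) : ℕ) • R = 0 := by
  obtain ⟨R, hR⟩ := exists_reducesTo_P h2
  have hred := reducesTo_two_pow h2 hR k (e_ne_zero_of_dvd_fermat h2 k hdvd)
  refine ⟨R, ?_, ?_⟩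
  · obtain ⟨m, n, r, -, -, h, hs⟩ := hred
    rw [hs]
    exact Affine.Point.some_ne_zero _
  · obtain ⟨m', n', h'⟩ := exists_represents_two_pow (k + 1)
    rw [two_pow_succ_nsmul] at h' ⊢
    exact hred.add_self_eq_zero h2 h' (by rw [← fermat_succ_mul, Nat.cast_mul, hdvd, zero_mul])

end Multiples

/-! ### Sums of two squares and the final congruences -/

theorem two_dvd_of_four_dvd_sq_add_sq {a b : ℤ} (h : 4 ∣ a ^ 2 + b ^ 2) : 2 ∣ a ∧ 2 ∣ b := by
  rcases Int.emod_two_eq_zero_or_one a with ha | ha <;>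
  rcases Int.emod_two_eq_zero_or_one b with hb | hb
  · exact ⟨Int.dvd_of_emod_eq_zero ha, Int.dvd_of_emod_eq_zero hb⟩
  all_goals
    exfalso
    obtain ⟨c, hc⟩ := h
    rw [← Int.ediv_mul_add_emod a 2, ← Int.ediv_mul_add_emod b 2, ha, hb] at hc
    generalize a / 2 = u at hc
    generalize b / 2 = v at hc
    ring_nf at hc
    omega

/-- Descent: modulo `4`, both `a` and `b` are even, and halving them removes a factor `4` from the
sum. -/
theorem two_pow_dvd_of_dvd_sq_add_sq (k : ℕ) (a b : ℤ) (h : 2 ^ (2 * k + 1) ∣ a ^ 2 + b ^ 2) :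
    2 ^ k ∣ a := by
  induction k generalizing a b with
  | zero => simp
  | succ k ih =>
    have e : (2 : ℤ) ^ (2 * (k + 1) + 1) = 4 * 2 ^ (2 * k + 1) := by ring
    rw [e] at h
    obtain ⟨⟨u, rfl⟩, ⟨v, rfl⟩⟩ := two_dvd_of_four_dvd_sq_add_sq (dvd_of_mul_right_dvd h)
    have e2 : (2 * u) ^ 2 + (2 * v) ^ 2 = 4 * (u ^ 2 + v ^ 2) := by ring
    rw [e2] at h
    rw [pow_succ']
    exact mul_dvd_mul_left 2 (ih u v (Int.dvd_of_mul_dvd_mul_left (by norm_num) h))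

theorem modEq_one_of_sq_add_sq {p s t : ℤ} {k : ℕ} (hst : s ^ 2 + t ^ 2 = 4 * p)
    (h : 2 ^ (2 * k + 1) ∣ p + 1 + s) : p ≡ 1 [ZMOD 2 ^ (k + 1)] := by
  obtain ⟨⟨u, rfl⟩, ⟨v, rfl⟩⟩ := two_dvd_of_four_dvd_sq_add_sq ⟨p, hst⟩
  -- Here `p = u² + v²`, and the right side is the norm of `1 + u + vi`.
  have e : p + 1 + 2 * u = (u + 1) ^ 2 + v ^ 2 := by linarith
  have hu : 2 ^ k ∣ u + 1 := two_pow_dvd_of_dvd_sq_add_sq k _ v (e ▸ h)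
  apply Int.ModEq.symm
  rw [Int.modEq_iff_dvd]
  have e2 : p - 1 = (p + 1 + 2 * u) - 2 * (u + 1) := by ring
  rw [e2]
  refine dvd_sub ((pow_dvd_pow 2 (by omega)).trans h) ?_
  rw [pow_succ']
  exact mul_dvd_mul_left 2 hu

end EllFermat

theorem mainTheorem10 (n p : ℕ) (hp : p.Prime) (hdvd : p ∣ EllFermat.fermat EllFermat.P n) :
    ((p : ℤ) ≡ 1 [ZMOD 4] → (p : ℤ) ≡ 1 [ZMOD 2 ^ n]) ∧
    ((p : ℤ) ≡ -1 [ZMOD 4] → (p : ℤ) ≡ -1 [ZMOD 2 ^ n]) := by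
  rcases n with _ | k
  · simp [Int.modEq_one]
  rcases hp.eq_two_or_odd with rfl | hodd
  -- The prime `2` is congruent to neither `1` nor `-1` modulo `4`.
  · exact ⟨fun h => absurd h (by decide), fun h => absurd h (by decide)⟩
  have : Fact p.Prime := ⟨hp⟩
  have hF : ringChar (ZMod p) ≠ 2 := by
    rw [ZMod.ringChar_zmod_n]
    rintro rfl
    omega
  have h2 : (2 : ZMod p) ≠ 0 := Ring.two_ne_zero hF
  obtain ⟨R, h0, h1⟩ := EllFermat.exists_point_of_dvd_fermat h2 k
    ((ZMod.natCast_eq_zero_iff _ _).2 hdvd)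
  have hcard := EllFermat.card_twist_point hF (neg_ne_zero.2 h2)
  have hneg := quadraticChar_neg_one hF
  rw [ZMod.card] at hcard hneg
  constructor
  · intro hp4
    have hp4' : p % 4 = 1 := by
      have : (p : ℤ) % 4 = 1 := hp4
      omega
    rw [ZMod.χ₄_nat_one_mod_four hp4'] at hneg
    obtain ⟨i, hi⟩ := (quadraticChar_one_iff_isSquare (neg_ne_zero.2 one_ne_zero)).1 hneg
    have hi2 : i ^ 2 = -1 := by rw [hi, pow_two]
    obtain ⟨t, ht⟩ := EllFermat.exists_jacobsthal_sq_add_sq hF hneg (neg_ne_zero.2 h2)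
    rw [ZMod.card] at ht
    refine EllFermat.modEq_one_of_sq_add_sq ht ?_
    rw [← hcard]
    exact_mod_cast EllFermat.two_pow_dvd_card_of_sq_eq_neg_one _
      (EllFermat.mulIHom_mul_self hi2) k R h0 h1
  · intro hp4
    have hp4' : p % 4 = 3 := by
      have : (p : ℤ) % 4 = (-1) % 4 := hp4
      omega
    rw [ZMod.χ₄_nat_three_mod_four hp4'] at hneg
    rw [EllFermat.jacobsthal_eq_zero_of_neg hneg, add_zero] at hcard
    have hord : addOrderOf R = 2 ^ (k + 1) := addOrderOf_eq_prime_pow h0 h1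
    apply Int.ModEq.symm
    rw [Int.modEq_iff_dvd, sub_neg_eq_add, ← hcard]
    have := addOrderOf_dvd_natCard R
    rw [hord] at this
    exact_mod_cast this
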